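/- **Theorem.** Let $(M,g)$ be a smooth ($C^\infty$) Riemannian manifold (without boundary) of dimension $n$, with Riemannian distance $d_M$. Then every connected, compact conic singular submanifold $W$ of $M$ is Lipschitz normally embedded: there is a constant $L>0$ such that $$d^W_{\mathrm{inn}}(x,x')\le L\, d_M(x,x')\qquad\text{for all } x,x'\in W,$$ where $d^W_{\mathrm{inn}}(x,x')\in[0,\infty]$ is the infimum of the $d_M$-lengths of the rectifiable paths lying in $W$ that join $x$ to $x'$. **Definitions.** Submanifolds are embedded, and their connected components may have different dimensions. The *spherical blow-up* of $\mathbb R^n$ at $a$ is the manifold with boundary $[\mathbb R^n,a]=[0,\infty)\times S^{n-1}$, with the map $\beta_a(r,u)=ru+a$ to $\mathbb R^n$. The *strict transform* $[S,a]$ of $S\subseteq\mathbb R^n$ is the closure of $\beta_a^{-1}(S\setminus\{a\})$ in $[\mathbb R^n,a]$. A subset $N$ of $[0,r)\times S^{n-1}$ is a *p-submanifold* if it is a smooth submanifold with boundary, its boundary is $\partial N=N\cap(\{0\}\times S^{n-1})$, and at each $x\in\partial N$ it is transverse to the boundary: $T_xN+T_x(\{0\}\times S^{n-1})=T_x([0,r)\times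 S^{n-1})$. A point $a$ is a *conic point* of $X\subseteq\mathbb R^n$ if $a\in X$, $X$ coincides with a closed set in a neighbourhood of $a$, and for some $r>0$ the set $[X\cap\{|x-a|<r\},a]\cap([0,r)\times S^{n-1})$ is a p-submanifold of $[0,r)\times S^{n-1}$. A subset $Z$ of $M$ is *conic at* $z\in Z$ if there is a smooth chart $\psi:U\to B^n$ of $M$ onto the open unit ball, with $\psi(z)=0$, such that $0$ is a conic point of $\psi(Z\cap U)$. A *singular point* of $Z\subseteq M$ is a point of $Z$ at which the germ of $Z$ is not that of a smooth submanifold (without boundary) of $M$. A subset $W$ of $M$ is a *conic singular submanifold* if it is closed in $M$, it is conic at each of its points, and the set of its singular points is finite (possibly empty). -/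

import Mathlib

open Set Topology Bundle
open scoped Manifold ContDiff ENNReal NNReal Bundle

noncomputable section

namespace ConicLNE

/-! ### Inner distance and Lipschitz normally embedded sets -/

/-- `γ`, restricted to `[0,1]`, is a continuous path lying in `S` and joining `x` to `y`. -/
def IsPathIn {M : Type*} [TopologicalSpace M] (S : Set M) (x y : M) (γ : ℝ → M) : Prop :=
  ContinuousOn γ (Icc 0 1) ∧ (∀ t ∈ Icc (0 : ℝ) 1, γ t ∈ S) ∧ γ 0 = x ∧ γ 1 = y

/-- The inner distance of `S`: the infimum of the lengths of the rectifiable paths lying in `S` that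
join `x` to `y` (it is `∞` if there is none). The length of a path is its total variation for the
distance of the ambient space; paths of infinite length do not affect the infimum. -/
def innerEDist {M : Type*} [PseudoEMetricSpace M] (S : Set M) (x y : M) : ℝ≥0∞ :=
  ⨅ (γ : ℝ → M) (_ : IsPathIn S x y γ), eVariationOn γ (Icc 0 1)

/-- `S` is Lipschitz normally embedded: its inner distance is at most a constant times its outer
distance, the restriction to `S` of the distance of the ambient space. -/
def IsLNE {M : Type*} [PseudoEMetricSpace M] (S : Set M) : Prop :=
  ∃ L : ℝ≥0, 0 < L ∧ ∀ x ∈ S, ∀ y ∈ S, innerEDist S x y ≤ L * edist x y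

/-! ### Embedded submanifolds, through local parametrizations -/

/-- `φ`, restricted to the open neighbourhood `V` of `0` in `ℝ^k`, is a smooth immersion and a
homeomorphism onto a (relatively) open neighbourhood of `p` in `N`, with `φ 0 = p`. -/
structure IsInteriorParam {F : Type*} [NormedAddCommGroup F] [NormedSpace ℝ F]
    (N : Set F) (p : F) {k : ℕ} (φ : EuclideanSpace ℝ (Fin k) → F)
    (V : Set (EuclideanSpace ℝ (Fin k))) : Prop where
  isOpen : IsOpen V
  zero_mem : 0 ∈ V
  map_zero : φ 0 = p
  smooth : ContDiffOn ℝ ∞ φ V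
  immersion : ∀ v ∈ V, Function.Injective (fderiv ℝ φ v)
  embedding : IsEmbedding (V.domRestrict φ)
  image : ∃ U : Set F, IsOpen U ∧ φ '' V = N ∩ U

/-- The germ of `N` at `p ∈ N` is that of a smooth submanifold (without boundary). The dimension `k`
of the submanifold may depend on the point. -/
def IsSmoothAt {F : Type*} [NormedAddCommGroup F] [NormedSpace ℝ F] (N : Set F) (p : F) : Prop :=
  ∃ (k : ℕ) (φ : EuclideanSpace ℝ (Fin k) → F) (V : Set (EuclideanSpace ℝ (Fin k))),
    IsInteriorParam N p φ V

/-- The half-space `[0,∞) × ℝ^k`. -/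
def halfSpace (k : ℕ) : Set (ℝ × EuclideanSpace ℝ (Fin k)) := {x | 0 ≤ x.1}

/-- `φ`, restricted to the relatively open neighbourhood `V ∩ halfSpace k` of `0` in the half-space,
is a smooth immersion and a homeomorphism onto a (relatively) open neighbourhood of `p` in `N`, with
`φ 0 = p`; so `p` is a boundary point of the manifold with boundary `N`. A map on a relatively
open subset of the half-space is smooth if it extends smoothly to an open set `V` of the
whole space, and `φ` is such an extension. -/
structure IsBoundaryParam {F : Type*} [NormedAddCommGroup F] [NormedSpace ℝ F]
    (N : Set F) (p : F) {k : ℕ} (φ : ℝ × EuclideanSpace ℝ (Fin k) → F)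
    (V : Set (ℝ × EuclideanSpace ℝ (Fin k))) : Prop where
  isOpen : IsOpen V
  zero_mem : 0 ∈ V
  map_zero : φ 0 = p
  smooth : ContDiffOn ℝ ∞ φ V
  immersion : ∀ v ∈ V ∩ halfSpace k, Function.Injective (fderiv ℝ φ v)
  embedding : IsEmbedding ((V ∩ halfSpace k).domRestrict φ)
  image : ∃ U : Set F, IsOpen U ∧ φ '' (V ∩ halfSpace k) = N ∩ U

/-! ### Spherical blow-up and strict transform -/

/-- The spherical blow-up `[ℝⁿ, a] = [0,∞) × S^{n-1}`, as a subset of `ℝ × ℝⁿ`. -/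
def blowUp (n : ℕ) : Set (ℝ × EuclideanSpace ℝ (Fin n)) := {q | 0 ≤ q.1 ∧ ‖q.2‖ = 1}

/-- The blowing-down map `(r, u) ↦ r u + a`. -/
def blowDown {n : ℕ} (a : EuclideanSpace ℝ (Fin n)) (q : ℝ × EuclideanSpace ℝ (Fin n)) :
    EuclideanSpace ℝ (Fin n) :=
  q.1 • q.2 + a

/-- The strict transform `[S, a]`: the closure in the blow-up of the preimage of `S \ {a}`. As the
blow-up is closed in `ℝ × ℝⁿ`, this is the closure in `ℝ × ℝⁿ`. -/
def strictTransform {n : ℕ} (S : Set (EuclideanSpace ℝ (Fin n))) (a : EuclideanSpace ℝ (Fin n)) :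
    Set (ℝ × EuclideanSpace ℝ (Fin n)) :=
  closure (blowUp n ∩ blowDown a ⁻¹' (S \ {a}))

/-- The tangent space of `[0,∞) × S^{n-1}` at `(t, u)`. -/
def tangentBlowUp {n : ℕ} (u : EuclideanSpace ℝ (Fin n)) :
    Submodule ℝ (ℝ × EuclideanSpace ℝ (Fin n)) :=
  (⊤ : Submodule ℝ ℝ).prod (Submodule.span ℝ {u})ᗮ

/-- The tangent space of the boundary `0 × S^{n-1}` of `[0,∞) × S^{n-1}` at `(0, u)`. -/
def tangentFrontFace {n : ℕ} (u : EuclideanSpace ℝ (Fin n)) :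
    Submodule ℝ (ℝ × EuclideanSpace ℝ (Fin n)) :=
  (⊥ : Submodule ℝ ℝ).prod (Submodule.span ℝ {u})ᗮ

/-- `N` is a p-submanifold of (an open subset of) the blow-up `[0,∞) × S^{n-1}`: a smooth embedded
submanifold with boundary, the boundary of `N` is the part of `N` that lies in the boundary
`0 × S^{n-1}`, and there `N` is transverse to `0 × S^{n-1}`. The connected components of `N` may have
different dimensions. As `[0,∞) × S^{n-1}` is an embedded submanifold with boundary of `ℝ × ℝⁿ`,
smoothness, immersions and embeddings may be tested in `ℝ × ℝⁿ`. The tangent space of `N` at a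
boundary point is the range of the derivative of a parametrization. -/
structure IsPSubmanifold {n : ℕ} (N : Set (ℝ × EuclideanSpace ℝ (Fin n))) : Prop where
  subset : N ⊆ blowUp n
  interior : ∀ p ∈ N, 0 < p.1 → IsSmoothAt N p
  boundary : ∀ p ∈ N, p.1 = 0 →
    ∃ (k : ℕ) (φ : ℝ × EuclideanSpace ℝ (Fin k) → ℝ × EuclideanSpace ℝ (Fin n))
      (V : Set (ℝ × EuclideanSpace ℝ (Fin k))),
      IsBoundaryParam N p φ V ∧
        LinearMap.range (fderiv ℝ φ 0).toLinearMap ⊔ tangentFrontFace p.2 = tangentBlowUp p.2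

/-! ### Conic points -/

/-- `a` is a conic point of `X ⊆ ℝⁿ`: the germ of `X` at `a` is non-empty and closed (that is, `a ∈ X`
and `X` agrees with a closed set near `a`), and for some `r > 0` the strict transform of
`X ∩ {|x - a| < r}` at `a` is a p-submanifold of `[0,r) × S^{n-1}`, in which it is closed. -/
def IsConicPoint {n : ℕ} (X : Set (EuclideanSpace ℝ (Fin n))) (a : EuclideanSpace ℝ (Fin n)) :
    Prop :=
  a ∈ X ∧ (∃ C U : Set (EuclideanSpace ℝ (Fin n)), IsClosed C ∧ IsOpen U ∧ a ∈ U ∧ X ∩ U = C ∩ U) ∧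
    ∃ r : ℝ, 0 < r ∧
      IsPSubmanifold (strictTransform (X ∩ Metric.ball a r) a ∩ {q | q.1 < r})

section Manifold

variable {n : ℕ} {M : Type*} [TopologicalSpace M] [ChartedSpace (EuclideanSpace ℝ (Fin n)) M]

/-- `ψ` is a smooth chart of `M` centred at `z` whose image is the open unit ball of `ℝⁿ`. -/
structure IsBallChart (z : M) (ψ : OpenPartialHomeomorph M (EuclideanSpace ℝ (Fin n))) : Prop where
  mem_atlas : ψ ∈ IsManifold.maximalAtlas (𝓡 n) ∞ M
  mem_source : z ∈ ψ.source
  centred : ψ z = 0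
  target : ψ.target = Metric.ball 0 1

/-- The subset `Z` of the manifold `M` is conic at `z`: it is so in a smooth chart at `z`. -/
def IsConicAt (n : ℕ) {M : Type*} [TopologicalSpace M] [ChartedSpace (EuclideanSpace ℝ (Fin n)) M]
    (Z : Set M) (z : M) : Prop :=
  ∃ ψ : OpenPartialHomeomorph M (EuclideanSpace ℝ (Fin n)),
    IsBallChart z ψ ∧ IsConicPoint (ψ '' (Z ∩ ψ.source)) (ψ z)

/-- The singular locus of `Z ⊆ M`: the points of `Z` at which the germ of `Z` is not that of a smooth
submanifold of `M`. -/
def singularLocus (n : ℕ) {M : Type*} [TopologicalSpace M]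
    [ChartedSpace (EuclideanSpace ℝ (Fin n)) M] (Z : Set M) : Set M :=
  {z | z ∈ Z ∧ ¬ ∃ ψ : OpenPartialHomeomorph M (EuclideanSpace ℝ (Fin n)),
    IsBallChart z ψ ∧ IsSmoothAt (ψ '' (Z ∩ ψ.source)) (ψ z)}

/-- `W` is a conic singular submanifold of the `n`-dimensional smooth manifold `M`. -/
structure IsConicSingularSubmanifold (n : ℕ) {M : Type*} [TopologicalSpace M]
    [ChartedSpace (EuclideanSpace ℝ (Fin n)) M] (W : Set M) : Prop where
  isClosed : IsClosed W
  conic : ∀ z ∈ W, IsConicAt n W z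
  finite_singularLocus : (singularLocus n W).Finite

end Manifold

end ConicLNE

end

/-!
By compactness and connectedness the estimate is a local one: far apart points are joined by finite
chains of inner distances, and there are only finitely many constants to compare. Smooth charts are
locally bi-Lipschitz, so it remains to treat a conic point `a` of a set in `ℝⁿ`.

At a point of the front face `{r = 0}`, transversality makes `r` a boundary-defining function of the
strict transform, which therefore has a bi-Lipschitz parametrization by a half-ball that preserves
`r`. Segments in the half-ball blow down to short paths, because `|r - r'|` and `r |u - u'|` are
both bounded by multiples of the distance from `a + r u` to `a + r' u'`. Points in directions close
to two different points of the front face are joined through `a`. The front face of the strict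
transform is compact, so one constant serves all these cases.
-/

namespace ConicLNE

section ContinuousMetric

theorem isContinuousRiemannianBundle_of_isContMDiffRiemannianBundle
    {EB : Type*} [NormedAddCommGroup EB] [NormedSpace ℝ EB]
    {HB : Type*} [TopologicalSpace HB] (IB : ModelWithCorners ℝ EB HB) (m : ℕ∞ω)
    {B : Type*} [TopologicalSpace B] [ChartedSpace HB B]
    (F : Type*) [NormedAddCommGroup F] [NormedSpace ℝ F]
    (E : B → Type*) [TopologicalSpace (TotalSpace F E)] [∀ x, NormedAddCommGroup (E x)]
    [∀ x, InnerProductSpace ℝ (E x)] [FiberBundle F E] [VectorBundle ℝ F E]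
    [h : IsContMDiffRiemannianBundle IB m F E] : IsContinuousRiemannianBundle F E :=
  have ⟨g, hg, hinner⟩ := h.exists_contMDiff
  ⟨g, hg.continuous, hinner⟩

instance isContinuousRiemannianBundle_vectorSpace {F : Type*} [NormedAddCommGroup F]
    [InnerProductSpace ℝ F] :
    IsContinuousRiemannianBundle F (fun x : F ↦ TangentSpace 𝓘(ℝ, F) x) :=
  isContinuousRiemannianBundle_of_isContMDiffRiemannianBundle 𝓘(ℝ, F) ω F _

end ContinuousMetric

section Riemannian

open Manifold MeasureTheory Metric

variable {E : Type*} [NormedAddCommGroup E] [NormedSpace ℝ E]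
  {H : Type*} [TopologicalSpace H] {I : ModelWithCorners ℝ E H}
  {M : Type*} [PseudoEMetricSpace M] [ChartedSpace H M]
  [RiemannianBundle (fun x : M ↦ TangentSpace I x)]
  {E' : Type*} [NormedAddCommGroup E'] [NormedSpace ℝ E']
  {H' : Type*} [TopologicalSpace H'] {I' : ModelWithCorners ℝ E' H'}
  {M' : Type*} [PseudoEMetricSpace M'] [ChartedSpace H' M']
  [RiemannianBundle (fun x : M' ↦ TangentSpace I' x)]
  {f : M → M'} {x : M}

theorem pathELength_comp_le {γ : ℝ → M} {a b : ℝ} {C : ℝ≥0}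
    (hγ : ∀ t ∈ Ioo a b, MDifferentiableAt 𝓘(ℝ, ℝ) I γ t)
    (hf : ∀ t ∈ Ioo a b, MDifferentiableAt I I' f (γ t))
    (hC : ∀ t ∈ Ioo a b, ∀ v : TangentSpace I (γ t), ‖mfderiv I I' f (γ t) v‖ₑ ≤ C * ‖v‖ₑ) :
    pathELength I' (f ∘ γ) a b ≤ C * pathELength I γ a b := by
  rw [pathELength_eq_lintegral_mfderiv_Ioo, pathELength_eq_lintegral_mfderiv_Ioo,
    ← lintegral_const_mul' _ _ ENNReal.coe_ne_top]
  refine setLIntegral_mono' measurableSet_Ioo fun t ht ↦ ?_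
  rw [mfderiv_comp t (hf t ht) (hγ t ht)]
  exact hC t ht _

theorem edist_map_le_mul_of_edist_lt [IsRiemannianManifold I M] [IsRiemannianManifold I' M']
    {y y' : M} {d : ℝ≥0∞} {C : ℝ≥0}
    (hf : ∀ w, edist y w < d → ContMDiffAt I I' 1 f w ∧
      ∀ v : TangentSpace I w, ‖mfderiv I I' f w v‖ₑ ≤ C * ‖v‖ₑ)
    (hd : edist y y' < d) : edist (f y) (f y') ≤ C * d := by
  rw [IsRiemannianManifold.out (I := I)] at hd
  obtain ⟨γ, hγ0, hγ1, hγ, hlen⟩ := exists_lt_of_riemannianEDist_lt hd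
  have hnear : ∀ t ∈ Icc (0 : ℝ) 1, edist y (γ t) < d := fun t ht ↦ by
    rw [IsRiemannianManifold.out (I := I)]
    calc riemannianEDist I y (γ t) ≤ pathELength I γ 0 t :=
          riemannianEDist_le_pathELength (hγ.mono (Icc_subset_Icc_right ht.2)) hγ0 rfl ht.1
      _ ≤ pathELength I γ 0 1 := pathELength_mono le_rfl ht.2
      _ < d := hlen
  have hfγ : ContMDiffOn 𝓘(ℝ, ℝ) I' 1 (f ∘ γ) (Icc 0 1) := fun t ht ↦
    (hf _ (hnear t ht)).1.comp_contMDiffWithinAt t (hγ t ht)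
  have hnear' : ∀ t ∈ Ioo (0 : ℝ) 1, edist y (γ t) < d := fun t ht ↦
    hnear t (Ioo_subset_Icc_self ht)
  calc edist (f y) (f y') ≤ pathELength I' (f ∘ γ) 0 1 := by
        rw [IsRiemannianManifold.out (I := I')]
        exact riemannianEDist_le_pathELength hfγ (by simp [hγ0]) (by simp [hγ1]) zero_le_one
    _ ≤ C * pathELength I γ 0 1 := pathELength_comp_le
        (fun t ht ↦ ((hγ t (Ioo_subset_Icc_self ht)).contMDiffAt
          (Icc_mem_nhds ht.1 ht.2)).mdifferentiableAt one_ne_zero)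
        (fun t ht ↦ (hf _ (hnear' t ht)).1.mdifferentiableAt one_ne_zero)
        fun t ht ↦ (hf _ (hnear' t ht)).2
    _ ≤ C * d := by gcongr

section Bound

variable [IsManifold I 1 M] [IsContinuousRiemannianBundle E (fun x : M ↦ TangentSpace I x)]
  [IsManifold I' 1 M'] [IsContinuousRiemannianBundle E' (fun x : M' ↦ TangentSpace I' x)]

theorem exists_eventually_enorm_mfderiv_le (hf : ContMDiffAt I I' 1 f x) :
    ∃ C : ℝ≥0, ∀ᶠ y in 𝓝 x, ∀ v : TangentSpace I y, ‖mfderiv I I' f y v‖ₑ ≤ C * ‖v‖ₑ := by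
  let T := trivializationAt E (TangentSpace I : M → Type _) x
  let T' := trivializationAt E' (TangentSpace I' : M' → Type _) (f x)
  let A : M → E →L[ℝ] E' := inTangentCoordinates I I' id f (mfderiv I I' f) x
  have hA : ContinuousAt A x := (hf.mfderiv_const (m := 0) (by simp)).continuousAt
  obtain ⟨C₁, -, hC₁⟩ := eventually_norm_trivializationAt_lt E (fun x : M ↦ TangentSpace I x) x
  obtain ⟨C₂, -, hC₂⟩ :=
    eventually_norm_symmL_trivializationAt_lt E' (fun x : M' ↦ TangentSpace I' x) (f x)
  have hT : ∀ᶠ y in 𝓝 x, y ∈ T.baseSet :=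
    T.open_baseSet.mem_nhds (FiberBundle.mem_baseSet_trivializationAt' x)
  have hT' : ∀ᶠ y in 𝓝 x, f y ∈ T'.baseSet := hf.continuousAt.eventually
    (T'.open_baseSet.mem_nhds (FiberBundle.mem_baseSet_trivializationAt' (f x)))
  refine ⟨(C₂ * ((‖A x‖ + 1) * C₁)).toNNReal, ?_⟩
  filter_upwards [hC₁, hf.continuousAt.eventually hC₂, hT, hT',
    hA.norm.eventually (gt_mem_nhds (lt_add_one ‖A x‖))] with y h₁ h₂ hy hy' hAy v
  have key : mfderiv I I' f y v =
      T'.symmL ℝ (f y) (A y (T.continuousLinearMapAt ℝ y v)) := by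
    simp only [A, inTangentCoordinates, ContinuousLinearMap.inCoordinates, id,
      ContinuousLinearMap.comp_apply]
    rw [T.symmL_continuousLinearMapAt hy, T'.symmL_continuousLinearMapAt hy']
  have hv : ‖mfderiv I I' f y v‖ ≤ C₂ * ((‖A x‖ + 1) * C₁) * ‖v‖ := by
    rw [key, mul_assoc, mul_assoc]
    exact ((T'.symmL ℝ (f y)).le_of_opNorm_le_of_le h₂.le ((A y).le_of_opNorm_le_of_le hAy.le
      ((T.continuousLinearMapAt ℝ y).le_of_opNorm_le h₁.le v)))
  rw [← ofReal_norm, ← ofReal_norm, ← ENNReal.ofReal, ← ENNReal.ofReal_mul' (norm_nonneg v)]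
  exact ENNReal.ofReal_le_ofReal hv

variable [IsRiemannianManifold I M] [IsRiemannianManifold I' M']

theorem exists_lipschitzOnWith_of_contMDiffAt (hf : ContMDiffAt I I' 1 f x) :
    ∃ C : ℝ≥0, ∃ s ∈ 𝓝 x, LipschitzOnWith C f s := by
  obtain ⟨C, hC⟩ := exists_eventually_enorm_mfderiv_le hf
  obtain ⟨c, hc, hball⟩ := EMetric.mem_nhds_iff.1
    (Filter.inter_mem ((contMDiffAt_iff_contMDiffAt_nhds (by simp)).1 hf) hC)
  have hc3 : 0 < c / 3 := ENNReal.div_pos hc.ne' (by simp)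
  refine ⟨C, eball x (c / 3), Metric.eball_mem_nhds x hc3, fun y hy y' hy' ↦ ?_⟩
  have hyy' : edist y y' < c / 3 + c / 3 :=
    (edist_triangle_right y y' x).trans_lt (ENNReal.add_lt_add hy hy')
  have hmem {w : M} (hw : edist y w < c / 3 + c / 3) : w ∈ eball x c :=
    calc edist w x ≤ edist y w + edist y x := edist_triangle_left _ _ _
      _ < c / 3 + c / 3 + c / 3 := ENNReal.add_lt_add hw hy
      _ = c := ENNReal.add_thirds c
  have := nhdsGT_neBot_of_exists_gt ⟨_, hyy'⟩
  have hlim : Filter.Tendsto ((C : ℝ≥0∞) * ·) (𝓝[>] edist y y') (𝓝 (C * edist y y')) :=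
    (ENNReal.continuous_const_mul ENNReal.coe_ne_top).continuousWithinAt
  refine ge_of_tendsto hlim ?_
  filter_upwards [Ioc_mem_nhdsGT hyy'] with d hd
  exact edist_map_le_mul_of_edist_lt (fun w hw ↦ hball (hmem (hw.trans_le hd.2))) hd.1

end Bound

end Riemannian

section Charts

variable {n : ℕ} {M : Type*} [PseudoEMetricSpace M]
  [ChartedSpace (EuclideanSpace ℝ (Fin n)) M] [IsManifold (𝓡 n) 1 M]
  [RiemannianBundle (fun x : M ↦ TangentSpace (𝓡 n) x)]
  [IsContinuousRiemannianBundle (EuclideanSpace ℝ (Fin n)) (fun x : M ↦ TangentSpace (𝓡 n) x)]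
  [IsRiemannianManifold (𝓡 n) M]
  {ψ : OpenPartialHomeomorph M (EuclideanSpace ℝ (Fin n))} {z : M}

theorem exists_lipschitzOnWith_chart (hψ : ψ ∈ IsManifold.maximalAtlas (𝓡 n) 1 M)
    (hz : z ∈ ψ.source) : ∃ C : ℝ≥0, ∃ s ∈ 𝓝 z, LipschitzOnWith C ψ s :=
  exists_lipschitzOnWith_of_contMDiffAt
    ((contMDiffOn_of_mem_maximalAtlas hψ).contMDiffAt (ψ.open_source.mem_nhds hz))

theorem exists_lipschitzOnWith_chart_symm (hψ : ψ ∈ IsManifold.maximalAtlas (𝓡 n) 1 M)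
    (hz : z ∈ ψ.source) : ∃ C : ℝ≥0, ∃ s ∈ 𝓝 (ψ z), LipschitzOnWith C ψ.symm s :=
  exists_lipschitzOnWith_of_contMDiffAt ((contMDiffOn_symm_of_mem_maximalAtlas hψ).contMDiffAt
    (ψ.open_target.mem_nhds (ψ.map_source hz)))

end Charts

section InnerDistance

variable {M : Type*} [PseudoEMetricSpace M] {S : Set M} {x y z : M}

/-- Local form of `IsLNE`: near `z`, the inner distance of `S` is at most a constant times the outer
distance. The comparison paths need not stay near `z`. -/
def IsLNEAt (S : Set M) (z : M) : Prop :=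
  ∃ L : ℝ≥0, ∀ᶠ p in 𝓝 (z, z), p.1 ∈ S → p.2 ∈ S → innerEDist S p.1 p.2 ≤ L * edist p.1 p.2

theorem innerEDist_le_of_lipschitzOnWith {γ : ℝ → M} {C : ℝ≥0}
    (hγ : LipschitzOnWith C γ (Icc 0 1)) (hS : MapsTo γ (Icc 0 1) S) :
    innerEDist S (γ 0) (γ 1) ≤ C := by
  calc innerEDist S (γ 0) (γ 1) ≤ eVariationOn γ (Icc 0 1) :=
        iInf₂_le γ ⟨hγ.continuousOn, hS, rfl, rfl⟩
    _ ≤ C * eVariationOn (id : ℝ → ℝ) (Icc 0 1) := hγ.comp_eVariationOn_le (mapsTo_id _)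
    _ = C := by rw [eVariationOn_id_Icc]; simp

theorem innerEDist_self (hx : x ∈ S) : innerEDist S x x = 0 := by
  simpa using innerEDist_le_of_lipschitzOnWith (γ := fun _ ↦ x) (C := 0)
    (LipschitzWith.const x).lipschitzOnWith fun _ _ ↦ hx

theorem isLNEAt_of_eventually_eq (h : ∀ᶠ x in 𝓝 z, x ∈ S → x = z) : IsLNEAt S z := by
  refine ⟨0, ?_⟩
  rw [nhds_prod_eq]
  filter_upwards [h.prod_mk h] with ⟨x, y⟩ ⟨hxz, hyz⟩ hx hy
  obtain rfl : x = y := (hxz hx).trans (hyz hy).symm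
  simp [innerEDist_self hx]

theorem innerEDist_map_le {N : Type*} [PseudoEMetricSpace N] {T : Set N} {f : M → N}
    {K : ℝ≥0} (hK : K ≠ 0) (hf : LipschitzOnWith K f S) (hT : MapsTo f S T) (x y : M) :
    innerEDist T (f x) (f y) ≤ K * innerEDist S x y := by
  simp only [innerEDist, ENNReal.mul_iInf_of_ne (ENNReal.coe_ne_zero.2 hK) ENNReal.coe_ne_top]
  refine le_iInf₂ fun γ ⟨hγ, hγS, h0, h1⟩ ↦ ?_
  exact (iInf₂_le (f ∘ γ) ⟨hf.continuousOn.comp hγ hγS, fun t ht ↦ hT (hγS t ht),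
    by simp [h0], by simp [h1]⟩).trans (hf.comp_eVariationOn_le hγS)

theorem innerEDist_comm (S : Set M) (x y : M) : innerEDist S x y = innerEDist S y x := by
  suffices h : ∀ x y, innerEDist S y x ≤ innerEDist S x y from (h y x).antisymm (h x y)
  intro x y
  have reverse : MapsTo (fun t : ℝ ↦ 1 - t) (Icc 0 1) (Icc 0 1) := fun t ht ↦
    ⟨by linarith [ht.2], by linarith [ht.1]⟩
  refine le_iInf₂ fun γ ⟨hγ, hγS, h0, h1⟩ ↦ ?_
  exact (iInf₂_le (γ ∘ fun t ↦ 1 - t) ⟨hγ.comp (by fun_prop) reverse,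
    fun t ht ↦ hγS _ (reverse ht), by simp [h1], by simp [h0]⟩).trans
    (eVariationOn.comp_le_of_antitoneOn _ _ (fun s _ t _ h ↦ by linarith) reverse)

theorem IsPathIn.exists_trans {γ δ : ℝ → M} (hγ : IsPathIn S x y γ) (hδ : IsPathIn S y z δ) :
    ∃ ε, IsPathIn S x z ε ∧
      eVariationOn ε (Icc 0 1) ≤ eVariationOn γ (Icc 0 1) + eVariationOn δ (Icc 0 1) := by
  obtain ⟨hγ, hγS, hγ0, hγ1⟩ := hγ
  obtain ⟨hδ, hδS, hδ0, hδ1⟩ := hδ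
  let ε : ℝ → M := fun t ↦ if t ≤ 1 / 2 then γ (2 * t) else δ (2 * t - 1)
  have left : EqOn ε (γ ∘ fun t ↦ 2 * t) (Icc 0 (1 / 2)) := fun t ht ↦ by
    simp only [ε, if_pos ht.2, Function.comp_apply]
  have right : EqOn ε (δ ∘ fun t ↦ 2 * t - 1) (Icc (1 / 2) 1) := fun t ht ↦ by
    rcases ht.1.eq_or_lt with rfl | h
    · simp [ε, hγ1, hδ0]
    · simp only [ε, if_neg h.not_ge, Function.comp_apply]
  have mapsTo_left : MapsTo (fun t : ℝ ↦ 2 * t) (Icc 0 (1 / 2)) (Icc 0 1) := fun t ht ↦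
    ⟨by linarith [ht.1], by linarith [ht.2]⟩
  have mapsTo_right : MapsTo (fun t : ℝ ↦ 2 * t - 1) (Icc (1 / 2) 1) (Icc 0 1) := fun t ht ↦
    ⟨by linarith [ht.1], by linarith [ht.2]⟩
  have halves : Icc (0 : ℝ) 1 = Icc 0 (1 / 2) ∪ Icc (1 / 2) 1 :=
    (Icc_union_Icc_eq_Icc (by norm_num) (by norm_num)).symm
  refine ⟨ε, ⟨?_, ?_, ?_, ?_⟩, ?_⟩
  · rw [halves]
    exact ((hγ.comp (by fun_prop) mapsTo_left).congr left).union_of_isClosed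
      ((hδ.comp (by fun_prop) mapsTo_right).congr right) isClosed_Icc isClosed_Icc
  · rw [halves]
    rintro t (ht | ht)
    · rw [left ht]; exact hγS _ (mapsTo_left ht)
    · rw [right ht]; exact hδS _ (mapsTo_right ht)
  · rw [left (by norm_num)]; simp [hγ0]
  · rw [right (by norm_num)]; norm_num [hδ1]
  · have hsplit := eVariationOn.Icc_add_Icc ε (s := univ) (a := 0) (b := 1 / 2) (c := 1)
      (by norm_num) (by norm_num) (mem_univ _)
    simp only [univ_inter] at hsplit
    rw [← hsplit, eVariationOn.congr left, eVariationOn.congr right]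
    exact add_le_add
      (eVariationOn.comp_le_of_monotoneOn _ _ (fun s _ t _ h ↦ by linarith) mapsTo_left)
      (eVariationOn.comp_le_of_monotoneOn _ _ (fun s _ t _ h ↦ by linarith) mapsTo_right)

theorem innerEDist_triangle (S : Set M) (x y z : M) :
    innerEDist S x z ≤ innerEDist S x y + innerEDist S y z := by
  simp only [innerEDist, ENNReal.add_iInf, ENNReal.iInf_add]
  refine le_iInf₂ fun δ hδ ↦ le_iInf₂ fun γ hγ ↦ ?_
  obtain ⟨ε, hε, hlen⟩ := hγ.exists_trans hδ
  exact (iInf₂_le ε hε).trans hlen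

theorem IsLNEAt.exists_eventually_innerEDist_le (h : IsLNEAt S z) (hz : z ∈ S) :
    ∃ D : ℝ≥0, ∀ᶠ y in 𝓝 z, y ∈ S → innerEDist S z y ≤ D := by
  obtain ⟨L, hL⟩ := h
  refine ⟨L, ?_⟩
  filter_upwards [(Continuous.prodMk_right z).continuousAt.eventually hL,
    Metric.eball_mem_nhds z one_pos] with y hy hyz hyS
  calc innerEDist S z y ≤ L * edist z y := hy hz hyS
    _ ≤ L * 1 := by gcongr; rw [edist_comm]; exact hyz.le
    _ = L := mul_one _

theorem innerEDist_lt_top_of_isPreconnected (hS : IsPreconnected S) (h : ∀ z ∈ S, IsLNEAt S z)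
    (hx : x ∈ S) (hy : y ∈ S) : innerEDist S x y < ⊤ := by
  refine hS.induction₂ (fun x y ↦ innerEDist S x y < ⊤) (fun z hz ↦ ?_)
    (fun x y z _ _ _ hxy hyz ↦ (innerEDist_triangle S x y z).trans_lt
      (ENNReal.add_lt_top.2 ⟨hxy, hyz⟩))
    (fun x y _ _ hxy ↦ by rwa [innerEDist_comm]) hx hy
  obtain ⟨D, hD⟩ := (h z hz).exists_eventually_innerEDist_le hz
  filter_upwards [mem_nhdsWithin_of_mem_nhds hD, self_mem_nhdsWithin] with y hy hyS
  exact (hy hyS).trans_lt ENNReal.coe_lt_top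

theorem exists_eventually_innerEDist_le_mul_edist {M : Type*} [EMetricSpace M] {S : Set M}
    (hS : IsPreconnected S) (h : ∀ z ∈ S, IsLNEAt S z) {a b : M} (ha : a ∈ S) (hb : b ∈ S) :
    ∃ L : ℝ≥0, ∀ᶠ p in 𝓝 (a, b), p.1 ∈ S → p.2 ∈ S →
      innerEDist S p.1 p.2 ≤ L * edist p.1 p.2 := by
  obtain rfl | hab := eq_or_ne a b
  · exact h a ha
  obtain ⟨D, hD⟩ := (h a ha).exists_eventually_innerEDist_le ha
  obtain ⟨D', hD'⟩ := (h b hb).exists_eventually_innerEDist_le hb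
  lift innerEDist S a b to ℝ≥0 using (innerEDist_lt_top_of_isPreconnected hS h ha hb).ne
    with m hm
  obtain ⟨e, he0, he⟩ := ENNReal.lt_iff_exists_nnreal_btwn.1 (edist_pos.2 hab)
  have far : ∀ᶠ p : M × M in 𝓝 (a, b), (e : ℝ≥0∞) < edist p.1 p.2 :=
    (continuous_edist.tendsto (a, b)).eventually (lt_mem_nhds he)
  refine ⟨(D + m + D') / e, ?_⟩
  filter_upwards [far, (continuous_fst.tendsto (a, b)).eventually hD,
    (continuous_snd.tendsto (a, b)).eventually hD'] with p hp hp₁ hp₂ h₁ h₂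
  calc innerEDist S p.1 p.2
      ≤ innerEDist S p.1 a + innerEDist S a b + innerEDist S b p.2 :=
        (innerEDist_triangle S _ b _).trans (by gcongr; exact innerEDist_triangle S _ a _)
    _ ≤ D + m + D' := by
        rw [innerEDist_comm S p.1 a, ← hm]
        gcongr
        exacts [hp₁ h₁, hp₂ h₂]
    _ = ((D + m + D') / e : ℝ≥0) * (e : ℝ≥0∞) := by
        rw [← ENNReal.coe_mul, div_mul_cancel₀ _ (ENNReal.coe_ne_zero.1 he0.ne'), ENNReal.coe_add,
          ENNReal.coe_add]
    _ ≤ ((D + m + D') / e : ℝ≥0) * edist p.1 p.2 := by gcongr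

theorem exists_eventually_nhdsSet_of_forall_exists {α X : Type*} [SemilatticeSup α] [Nonempty α]
    [TopologicalSpace X] {K : Set X} (hK : IsCompact K) {P : α → X → Prop}
    (mono : ∀ x, Monotone (P · x)) (h : ∀ x ∈ K, ∃ a, ∀ᶠ y in 𝓝 x, P a y) :
    ∃ a, ∀ᶠ y in 𝓝ˢ K, P a y := by
  refine hK.induction_on (p := fun s ↦ ∃ a, ∀ᶠ y in 𝓝ˢ s, P a y) ⟨Classical.arbitrary α, by simp⟩
    (fun s t hst ⟨a, ha⟩ ↦ ⟨a, ha.filter_mono (nhdsSet_mono hst)⟩) ?_ fun x hx ↦ ?_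
  · rintro s t ⟨a, ha⟩ ⟨b, hb⟩
    refine ⟨a ⊔ b, ?_⟩
    rw [nhdsSet_union, Filter.eventually_sup]
    exact ⟨ha.mono fun y ↦ mono y le_sup_left, hb.mono fun y ↦ mono y le_sup_right⟩
  · obtain ⟨a, ha⟩ := h x hx
    exact ⟨interior {y | P a y}, mem_nhdsWithin_of_mem_nhds (interior_mem_nhds.2 ha), a,
      subset_interior_iff_mem_nhdsSet.1 Subset.rfl⟩

theorem isLNE_of_forall_isLNEAt {M : Type*} [EMetricSpace M] {S : Set M} (hS : IsCompact S)
    (hS' : IsPreconnected S) (h : ∀ z ∈ S, IsLNEAt S z) : IsLNE S := by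
  obtain ⟨L, hL⟩ := exists_eventually_nhdsSet_of_forall_exists (hS.prod hS)
    (P := fun (L : ℝ≥0) p ↦ p.1 ∈ S → p.2 ∈ S → innerEDist S p.1 p.2 ≤ L * edist p.1 p.2)
    (fun p a b hab hp h₁ h₂ ↦ (hp h₁ h₂).trans (by gcongr))
    fun p hp ↦ exists_eventually_innerEDist_le_mul_edist hS' h hp.1 hp.2
  refine ⟨L + 1, by positivity, fun x hx y hy ↦ ?_⟩
  calc innerEDist S x y ≤ L * edist x y := hL.self_of_nhdsSet (x, y) ⟨hx, hy⟩ hx hy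
    _ ≤ (L + 1 : ℝ≥0) * edist x y := by gcongr; exact le_self_add

end InnerDistance

section TangentCones

variable {E F : Type*} [NormedAddCommGroup E] [NormedSpace ℝ E] [NormedAddCommGroup F]
  [NormedSpace ℝ F] {f : E → F} {f' : E →L[ℝ] F} {x : E} {s : Set E} {t : Set F}

theorem mapsTo_posTangentConeAt (hf : HasFDerivAt f f' x) (h : ∀ᶠ y in 𝓝[s] x, f y ∈ t) :
    MapsTo f' (posTangentConeAt s x) (posTangentConeAt t (f x)) := by
  intro y hy
  obtain ⟨ι, l, hl, c, d, hd, hds, hcd⟩ := exists_fun_of_mem_tangentConeAt hy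
  have hd' : Filter.Tendsto (fun i ↦ x + d i) l (𝓝[s] x) :=
    tendsto_nhdsWithin_iff.2 ⟨by simpa using tendsto_const_nhds.add hd, hds⟩
  refine mem_tangentConeAt_of_seq l c (fun i ↦ f (x + d i) - f x) ?_ ?_
    (hf.hasFDerivWithinAt.lim hd hds hcd)
  · exact tendsto_sub_nhds_zero_iff.2 (hf.continuousAt.tendsto.comp (hd'.mono_right inf_le_left))
  · simpa using hd'.eventually h

variable [FiniteDimensional ℝ E] [FiniteDimensional ℝ F]

theorem exists_hasStrictFDerivAt_leftInverse (hf : HasStrictFDerivAt f f' x)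
    (hinj : Function.Injective f') :
    ∃ (g : F → E) (g' : F →L[ℝ] E), HasStrictFDerivAt g g' (f x) ∧
      (∀ᶠ y in 𝓝 x, g (f y) = y) ∧ Function.LeftInverse g' f' := by
  have := FiniteDimensional.complete ℝ E
  obtain ⟨A, hA⟩ := f'.toLinearMap.exists_leftInverse_of_injective (LinearMap.ker_eq_bot.2 hinj)
  let g' : F →L[ℝ] E := LinearMap.toContinuousLinearMap A
  have hg' : Function.LeftInverse g' f' := LinearMap.congr_fun hA
  have hcomp : HasStrictFDerivAt (g' ∘ f) (ContinuousLinearEquiv.refl ℝ E : E →L[ℝ] E) x := by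
    have hid : g'.comp f' = (ContinuousLinearEquiv.refl ℝ E : E →L[ℝ] E) :=
      ContinuousLinearMap.ext hg'
    exact hid ▸ g'.hasStrictFDerivAt.comp x hf
  refine ⟨hcomp.localInverse _ _ _ ∘ g', g', ?_, hcomp.eventually_left_inverse, hg'⟩
  have h := hcomp.to_localInverse.comp (f x) g'.hasStrictFDerivAt
  rwa [ContinuousLinearEquiv.refl_symm, ContinuousLinearEquiv.coe_refl,
    ContinuousLinearMap.id_comp] at h

theorem exists_antilipschitzWith_restrict (hf : HasStrictFDerivAt f f' x)
    (hinj : Function.Injective f') :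
    ∃ (K : ℝ≥0), ∃ u ∈ 𝓝 x, AntilipschitzWith K (u.domRestrict f) := by
  obtain ⟨g, g', hg, hleft, -⟩ := exists_hasStrictFDerivAt_leftInverse hf hinj
  obtain ⟨K, v, hv, hK⟩ := hg.exists_lipschitzOnWith
  refine ⟨K, _, Filter.inter_mem (hf.continuousAt.preimage_mem_nhds hv) hleft, ?_⟩
  rintro ⟨y, hyv, hy⟩ ⟨z, hzv, hz⟩
  have h := hK hyv hzv
  rwa [show g (f y) = y from hy, show g (f z) = z from hz] at h

theorem posTangentConeAt_eq_image (hf : HasStrictFDerivAt f f' x) (hinj : Function.Injective f')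
    (hst : Filter.map f (𝓝[s] x) = 𝓝[t] (f x)) :
    posTangentConeAt t (f x) = f' '' posTangentConeAt s x := by
  obtain ⟨g, g', hg, hleft, hg'⟩ := exists_hasStrictFDerivAt_leftInverse hf hinj
  have hgx : g (f x) = x := hleft.self_of_nhds
  have htendsto : Filter.Tendsto f (𝓝[s] x) (𝓝[t] (f x)) := hst.le
  refine Subset.antisymm (fun w hw ↦ ?_)
    (mapsTo_posTangentConeAt hf.hasFDerivAt (htendsto self_mem_nhdsWithin)).image_subset
  have hlift : ∀ᶠ q in 𝓝[t] (f x), g q ∈ s ∧ f (g q) = q := by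
    rw [← hst, Filter.eventually_map]
    filter_upwards [self_mem_nhdsWithin, nhdsWithin_le_nhds hleft] with y hy hgy
    rw [hgy]
    exact ⟨hy, rfl⟩
  have hg'w : g' w ∈ posTangentConeAt s x := by
    have h := mapsTo_posTangentConeAt hg.hasFDerivAt (hlift.mono fun q h ↦ h.1) hw
    rwa [hgx] at h
  refine ⟨g' w, hg'w, ?_⟩
  have hfg : HasFDerivWithinAt (f ∘ g) (f'.comp g') t (f x) := by
    rw [← hgx] at hf
    exact (hf.hasFDerivAt.comp (f x) hg.hasFDerivAt).hasFDerivWithinAt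
  have hid : HasFDerivWithinAt (f ∘ g) (ContinuousLinearMap.id ℝ F) t (f x) :=
    (hasFDerivWithinAt_id (f x) t).congr_of_eventuallyEq (hlift.mono fun q h ↦ h.2)
      (congrArg f hgx)
  exact hfg.unique_on hid (tangentConeAt_mono_field hw)

end TangentCones

theorem map_nhdsWithin_eq_of_isEmbedding {X Y : Type*} [TopologicalSpace X] [TopologicalSpace Y]
    {f : X → Y} {s : Set X} (hf : IsEmbedding (s.domRestrict f)) {x : X} (hx : x ∈ s) :
    Filter.map f (𝓝[s] x) = 𝓝[f '' s] (f x) := by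
  have h := hf.map_nhds_eq ⟨x, hx⟩
  rw [Set.range_domRestrict] at h
  rw [nhdsWithin_eq_map_subtype_coe hx, Filter.map_map]
  exact h

section BoundaryPoints

theorem zero_mem_halfSpace (k : ℕ) : 0 ∈ halfSpace k := le_refl (0 : ℝ)

theorem convex_halfSpace (k : ℕ) : Convex ℝ (halfSpace k) :=
  convex_halfSpace_ge (LinearMap.fst ℝ ℝ _).isLinear 0

theorem posTangentConeAt_halfSpace {k : ℕ} {x : ℝ × EuclideanSpace ℝ (Fin k)} (hx : x.1 = 0) :
    posTangentConeAt (halfSpace k) x = halfSpace k := by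
  have hx' : x ∈ halfSpace k := hx.ge
  refine Subset.antisymm (fun y hy ↦ ?_) fun y hy ↦ ?_
  · have hmin : IsLocalMinOn Prod.fst (halfSpace k) x :=
      Filter.eventually_of_mem self_mem_nhdsWithin fun z hz ↦ hx.le.trans hz
    exact hmin.hasFDerivWithinAt_nonneg hasFDerivWithinAt_fst hy
  · refine mem_posTangentConeAt_of_segment_subset ((convex_halfSpace k).segment_subset hx' ?_)
    exact add_nonneg hx.ge hy

variable {F : Type*} [NormedAddCommGroup F] [NormedSpace ℝ F] {N : Set F} {p : F} {k : ℕ}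

section Interior

variable {φ : EuclideanSpace ℝ (Fin k) → F} {V : Set (EuclideanSpace ℝ (Fin k))}
  {x : EuclideanSpace ℝ (Fin k)}

theorem IsInteriorParam.hasStrictFDerivAt (h : IsInteriorParam N p φ V) (hx : x ∈ V) :
    HasStrictFDerivAt φ (fderiv ℝ φ x) x :=
  (h.smooth.contDiffAt (h.isOpen.mem_nhds hx)).hasStrictFDerivAt (by simp)

theorem IsInteriorParam.map_nhds (h : IsInteriorParam N p φ V) (hx : x ∈ V) :
    Filter.map φ (𝓝 x) = 𝓝[N] (φ x) := by
  obtain ⟨U, hU, hUV⟩ := h.image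
  have hxU : φ x ∈ U := (hUV.subset (mem_image_of_mem φ hx)).2
  rw [nhdsWithin_eq_nhdsWithin hxU hU (t := N) (u := φ '' V) (by rw [hUV, inter_assoc, inter_self]),
    ← map_nhdsWithin_eq_of_isEmbedding h.embedding hx, h.isOpen.nhdsWithin_eq hx]

theorem IsInteriorParam.posTangentConeAt_eq [FiniteDimensional ℝ F] (h : IsInteriorParam N p φ V)
    (hx : x ∈ V) : posTangentConeAt N (φ x) = range (fderiv ℝ φ x) := by
  rw [posTangentConeAt_eq_image (s := univ) (h.hasStrictFDerivAt hx) (h.immersion x hx)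
    (by rw [nhdsWithin_univ, h.map_nhds hx]), posTangentConeAt_univ, image_univ]

end Interior

variable {φ : ℝ × EuclideanSpace ℝ (Fin k) → F} {V : Set (ℝ × EuclideanSpace ℝ (Fin k))}
  {x : ℝ × EuclideanSpace ℝ (Fin k)}

theorem IsBoundaryParam.hasStrictFDerivAt (h : IsBoundaryParam N p φ V) (hx : x ∈ V) :
    HasStrictFDerivAt φ (fderiv ℝ φ x) x :=
  (h.smooth.contDiffAt (h.isOpen.mem_nhds hx)).hasStrictFDerivAt (by simp)

theorem IsBoundaryParam.map_nhdsWithin (h : IsBoundaryParam N p φ V) (hx : x ∈ V ∩ halfSpace k) :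
    Filter.map φ (𝓝[halfSpace k] x) = 𝓝[N] (φ x) := by
  obtain ⟨U, hU, hUV⟩ := h.image
  have hxU : φ x ∈ U := (hUV.subset (mem_image_of_mem φ hx)).2
  rw [nhdsWithin_eq_nhdsWithin hxU hU (t := N) (u := φ '' (V ∩ halfSpace k))
      (by rw [hUV, inter_assoc, inter_self]),
    ← map_nhdsWithin_eq_of_isEmbedding h.embedding hx,
    nhdsWithin_inter_of_mem (nhdsWithin_le_nhds (h.isOpen.mem_nhds hx.1))]

theorem IsBoundaryParam.posTangentConeAt_eq [FiniteDimensional ℝ F] (h : IsBoundaryParam N p φ V)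
    (hx : x ∈ V) (hx0 : x.1 = 0) : posTangentConeAt N (φ x) = fderiv ℝ φ x '' halfSpace k := by
  have hx' : x ∈ V ∩ halfSpace k := ⟨hx, hx0.ge⟩
  rw [posTangentConeAt_eq_image (h.hasStrictFDerivAt hx) (h.immersion x hx')
    (h.map_nhdsWithin hx'), posTangentConeAt_halfSpace hx0]

-- At an interior point the tangent cone is a linear subspace, at a boundary point a half-space.
theorem IsBoundaryParam.not_isSmoothAt [FiniteDimensional ℝ F] (h : IsBoundaryParam N p φ V)
    (hx : x ∈ V) (hx0 : x.1 = 0) : ¬ IsSmoothAt N (φ x) := by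
  rintro ⟨m, χ, V', hχ⟩
  have hcone : fderiv ℝ φ x '' halfSpace k = range (fderiv ℝ χ 0) := by
    rw [← h.posTangentConeAt_eq hx hx0, ← hχ.posTangentConeAt_eq hχ.zero_mem, hχ.map_zero]
  have hinward : fderiv ℝ φ x (1, 0) ∈ fderiv ℝ φ x '' halfSpace k :=
    mem_image_of_mem _ (zero_le_one (α := ℝ))
  have houtward : fderiv ℝ φ x (-(1, 0)) ∈ fderiv ℝ φ x '' halfSpace k := by
    rw [hcone] at hinward ⊢
    obtain ⟨v, hv⟩ := hinward
    exact ⟨-v, by rw [map_neg, map_neg, hv]⟩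
  rw [(h.immersion x ⟨hx, hx0.ge⟩).mem_set_image] at houtward
  exact absurd (show (0 : ℝ) ≤ -1 from houtward) (by norm_num)

end BoundaryPoints

section Straightening

variable {E : Type*} [NormedAddCommGroup E] [NormedSpace ℝ E] {f : ℝ × E → ℝ} {α : ℝ}

theorem eventually_nonneg_iff_fst_nonneg
    (hf : HasStrictFDerivAt f (α • ContinuousLinearMap.fst ℝ ℝ E) 0) (hα : 0 < α)
    (hf0 : ∀ᶠ y in 𝓝 0, y.1 = 0 → f y = 0) : ∀ᶠ y in 𝓝 0, 0 ≤ f y ↔ 0 ≤ y.1 := by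
  have hcont : Continuous fun y : ℝ × E ↦ (y, ((0 : ℝ), y.2)) := by fun_prop
  have hcont' : Continuous fun y : ℝ × E ↦ ((0 : ℝ), y.2) := by fun_prop
  filter_upwards [(hcont.tendsto' 0 (0, 0) rfl).eventually (hf.isLittleO.def (half_pos hα)),
    (hcont'.tendsto' 0 0 rfl).eventually hf0] with y hy hy0
  have hbound : |f y - α * y.1| ≤ α / 2 * |y.1| := by
    simpa [hy0 rfl, Prod.norm_def] using hy
  have hle := abs_le.1 hbound
  constructor <;> intro h
  · by_contra! hneg
    rw [abs_of_neg hneg] at hle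
    nlinarith
  · rw [abs_of_nonneg h] at hle
    nlinarith

theorem exists_straightening [CompleteSpace E]
    (hf : HasStrictFDerivAt f (α • ContinuousLinearMap.fst ℝ ℝ E) 0) (hα : 0 < α)
    (hf0 : ∀ᶠ y in 𝓝 0, y.1 = 0 → f y = 0) :
    ∃ (Ψ : ℝ × E → ℝ × E) (Ψ' : (ℝ × E) ≃L[ℝ] (ℝ × E)), Ψ 0 = 0 ∧
      HasStrictFDerivAt Ψ (Ψ' : (ℝ × E) →L[ℝ] (ℝ × E)) 0 ∧ (∀ᶠ y in 𝓝 0, f (Ψ y) = y.1) ∧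
      Filter.map Ψ (𝓝[{y | 0 ≤ y.1}] 0) = 𝓝[{y | 0 ≤ y.1}] 0 := by
  let e : (ℝ × E) ≃L[ℝ] (ℝ × E) :=
    (ContinuousLinearEquiv.unitsEquivAut ℝ (Units.mk0 α hα.ne')).prodCongr
      (ContinuousLinearEquiv.refl ℝ E)
  let Φ : ℝ × E → ℝ × E := fun y ↦ (f y, y.2)
  have hΦ : HasStrictFDerivAt Φ (e : (ℝ × E) →L[ℝ] (ℝ × E)) 0 := by
    have he : (α • ContinuousLinearMap.fst ℝ ℝ E).prod (ContinuousLinearMap.snd ℝ ℝ E) = e := by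
      ext y <;> simp [e, mul_comm]
    exact he ▸ hf.prodMk hasStrictFDerivAt_snd
  have hΦ0 : Φ 0 = 0 := Prod.ext (hf0.self_of_nhds rfl) rfl
  let Ψ := hΦ.localInverse Φ e 0
  have hΨ : HasStrictFDerivAt Ψ (e.symm : (ℝ × E) →L[ℝ] (ℝ × E)) 0 := by
    simpa [hΦ0] using hΦ.to_localInverse
  have hΨ0 : Ψ 0 = 0 := by simpa [hΦ0] using hΦ.localInverse_apply_image
  have hfst : ∀ᶠ y in 𝓝 0, f (Ψ y) = y.1 := by
    have h : ∀ᶠ y in 𝓝 0, Φ (Ψ y) = y := by simpa [hΦ0] using hΦ.eventually_right_inverse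
    exact h.mono fun y hy ↦ congrArg Prod.fst hy
  have hmap : Filter.map Ψ (𝓝 0) = 𝓝 0 := by
    simpa [hΨ0] using hΨ.map_nhds_eq_of_equiv
  refine ⟨Ψ, e.symm, hΨ0, hΨ, hfst, ?_⟩
  have hsign : ∀ᶠ y in 𝓝 0, 0 ≤ f (Ψ y) ↔ 0 ≤ (Ψ y).1 :=
    hmap.le (eventually_nonneg_iff_fst_nonneg hf hα hf0)
  have hhalf : 𝓝[{y | 0 ≤ y.1}] (0 : ℝ × E) = 𝓝[Ψ ⁻¹' {y | 0 ≤ y.1}] 0 :=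
    nhdsWithin_eq_iff_eventuallyEq.2 <| by
      filter_upwards [hfst, hsign] with y hy hy'
      exact propext (show 0 ≤ y.1 ↔ 0 ≤ (Ψ y).1 from hy ▸ hy')
  calc Filter.map Ψ (𝓝[{y | 0 ≤ y.1}] 0)
      = Filter.map Ψ (𝓝 0 ⊓ Filter.principal (Ψ ⁻¹' {y | 0 ≤ y.1})) := by
        rw [hhalf, nhdsWithin]
    _ = 𝓝[{y | 0 ≤ y.1}] 0 := by rw [Filter.map_inf_principal_preimage, hmap, nhdsWithin]

end Straightening

section Collar

variable {n k : ℕ} {N : Set (ℝ × EuclideanSpace ℝ (Fin n))} {p : ℝ × EuclideanSpace ℝ (Fin n)}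
  {φ : ℝ × EuclideanSpace ℝ (Fin k) → ℝ × EuclideanSpace ℝ (Fin n)}
  {V : Set (ℝ × EuclideanSpace ℝ (Fin k))} {x : ℝ × EuclideanSpace ℝ (Fin k)}

/-- The half-ball of radius `ε` in `[0,∞) × ℝ^k`, for the sup norm of `ℝ × ℝ^k`. -/
def halfBall (k : ℕ) (ε : ℝ) : Set (ℝ × EuclideanSpace ℝ (Fin k)) :=
  Metric.ball 0 ε ∩ halfSpace k

/-- `G` is a bi-Lipschitz parametrization, by a half-ball, of a piece of `N ⊆ ℝ × ℝⁿ`, and it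
preserves the first coordinate (the radius, when `N` is part of a blow-up). -/
structure IsRadialCollar (N : Set (ℝ × EuclideanSpace ℝ (Fin n)))
    (G : ℝ × EuclideanSpace ℝ (Fin k) → ℝ × EuclideanSpace ℝ (Fin n)) (K : ℝ≥0) (ε : ℝ) :
    Prop where
  mapsTo : MapsTo G (halfBall k ε) N
  fst_eq : ∀ y ∈ halfBall k ε, (G y).1 = y.1
  lipschitz : LipschitzOnWith K G (halfBall k ε)
  antilipschitz : AntilipschitzWith K ((halfBall k ε).domRestrict G)

theorem IsPSubmanifold.fst_eq_zero (hN : IsPSubmanifold N) (h : IsBoundaryParam N p φ V)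
    (hx : x ∈ V) (hx0 : x.1 = 0) : (φ x).1 = 0 := by
  obtain ⟨U, -, hU⟩ := h.image
  have hxN : φ x ∈ N := (hU.subset (mem_image_of_mem φ ⟨hx, hx0.ge⟩)).1
  by_contra hne
  exact h.not_isSmoothAt hx hx0 (hN.interior _ hxN ((hN.subset hxN).1.lt_of_ne (Ne.symm hne)))

theorem IsPSubmanifold.exists_fst_fderiv_eq (hN : IsPSubmanifold N) (hp0 : p.1 = 0)
    (h : IsBoundaryParam N p φ V)
    (ht : LinearMap.range (fderiv ℝ φ 0).toLinearMap ⊔ tangentFrontFace p.2 = tangentBlowUp p.2) :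
    ∃ α : ℝ, 0 < α ∧ ∀ y, (fderiv ℝ φ 0 y).1 = α * y.1 := by
  -- the radial coordinate attains its minimum over the half-space at `0`
  have hmin : IsLocalMinOn (fun y ↦ (φ y).1) (halfSpace k) 0 := by
    have hmem : ∀ᶠ y in 𝓝[halfSpace k] 0, φ y ∈ N :=
      (h.map_nhdsWithin ⟨h.zero_mem, zero_mem_halfSpace k⟩).le self_mem_nhdsWithin
    filter_upwards [hmem] with y hy
    simpa only [h.map_zero, hp0] using (hN.subset hy).1
  have hderiv := (h.hasStrictFDerivAt h.zero_mem).hasFDerivAt.fst.hasFDerivWithinAt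
    (s := halfSpace k)
  have hcone := posTangentConeAt_halfSpace (k := k) (x := 0) rfl
  have hvertical (v : EuclideanSpace ℝ (Fin k)) : (fderiv ℝ φ 0 (0, v)).1 = 0 :=
    hmin.hasFDerivWithinAt_eq_zero hderiv (hcone.superset (le_refl (0 : ℝ)))
      (hcone.superset (neg_zero (G := ℝ)).ge)
  have hinward : 0 ≤ (fderiv ℝ φ 0 (1, 0)).1 :=
    hmin.hasFDerivWithinAt_nonneg hderiv (hcone.superset (zero_le_one (α := ℝ)))
  have hlin : ∀ y, (fderiv ℝ φ 0 y).1 = (fderiv ℝ φ 0 (1, 0)).1 * y.1 := by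
    rintro ⟨r, v⟩
    have hdecomp : ((r, v) : ℝ × EuclideanSpace ℝ (Fin k)) = r • (1, 0) + (0, v) := by simp
    rw [hdecomp, map_add, map_smul, Prod.fst_add, hvertical]
    simp [mul_comm]
  refine ⟨_, hinward.lt_of_ne fun hα ↦ ?_, hlin⟩
  have hradial : ((1, 0) : ℝ × EuclideanSpace ℝ (Fin n)) ∈ tangentBlowUp p.2 := by
    simp [tangentBlowUp, Submodule.mem_prod]
  rw [← ht, Submodule.mem_sup] at hradial
  obtain ⟨_, ⟨y, rfl⟩, z, hz, hyz⟩ := hradial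
  have hy1 : (fderiv ℝ φ 0 y).1 = 0 := by rw [hlin y, ← hα, zero_mul]
  have hz1 : z.1 = 0 := hz.1
  have hsum : (fderiv ℝ φ 0 y).1 + z.1 = 1 := congrArg Prod.fst hyz
  rw [hy1, hz1] at hsum
  norm_num at hsum

theorem exists_isRadialCollar_of_hasStrictFDerivAt
    {G : ℝ × EuclideanSpace ℝ (Fin k) → ℝ × EuclideanSpace ℝ (Fin n)}
    {G' : ℝ × EuclideanSpace ℝ (Fin k) →L[ℝ] ℝ × EuclideanSpace ℝ (Fin n)}
    (hG : HasStrictFDerivAt G G' 0) (hinj : Function.Injective G')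
    (hN : ∀ᶠ y in 𝓝[halfSpace k] 0, G y ∈ N) (hfst : ∀ᶠ y in 𝓝[halfSpace k] 0, (G y).1 = y.1)
    {ρ : ℝ} (hρ : 0 < ρ) :
    ∃ (K : ℝ≥0) (ε : ℝ), 0 < ε ∧ ε ≤ ρ ∧ IsRadialCollar N G K ε := by
  obtain ⟨K₁, s₁, hs₁, hK₁⟩ := hG.exists_lipschitzOnWith
  obtain ⟨K₂, s₂, hs₂, hK₂⟩ := exists_antilipschitzWith_restrict hG hinj
  have hs : s₁ ∩ s₂ ∈ 𝓝[halfSpace k] 0 := nhdsWithin_le_nhds (Filter.inter_mem hs₁ hs₂)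
  obtain ⟨δ, hδ, hball⟩ := Metric.mem_nhdsWithin_iff.1 (Filter.inter_mem hs (hN.and hfst))
  have hsub : ∀ y ∈ halfBall k (min δ ρ), (y ∈ s₁ ∧ y ∈ s₂) ∧ G y ∈ N ∧ (G y).1 = y.1 :=
    fun y hy ↦ hball ⟨Metric.ball_subset_ball (min_le_left _ _) hy.1, hy.2⟩
  refine ⟨max K₁ K₂, min δ ρ, lt_min hδ hρ, min_le_right _ _,
    ⟨fun y hy ↦ (hsub y hy).2.1, fun y hy ↦ (hsub y hy).2.2,
      (hK₁.mono fun y hy ↦ (hsub y hy).1.1).weaken (le_max_left _ _), fun y z ↦ ?_⟩⟩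
  exact (hK₂ ⟨y, (hsub y y.2).1.2⟩ ⟨z, (hsub z z.2).1.2⟩).trans
    (by gcongr; exacts [le_max_right _ _, le_rfl])

theorem IsPSubmanifold.exists_isRadialCollar (hN : IsPSubmanifold N) (hp : p ∈ N) (hp0 : p.1 = 0)
    {ρ : ℝ} (hρ : 0 < ρ) :
    ∃ (k : ℕ) (G : ℝ × EuclideanSpace ℝ (Fin k) → ℝ × EuclideanSpace ℝ (Fin n)) (K : ℝ≥0) (ε : ℝ),
      ε ≤ ρ ∧ IsRadialCollar N G K ε ∧ G '' halfBall k ε ∈ 𝓝[N] p := by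
  obtain ⟨k, φ, V, h, ht⟩ := hN.boundary p hp hp0
  have h0 : (0 : ℝ × EuclideanSpace ℝ (Fin k)) ∈ V ∩ halfSpace k :=
    ⟨h.zero_mem, zero_mem_halfSpace k⟩
  have hφ := h.hasStrictFDerivAt h.zero_mem
  obtain ⟨α, hα, hlin⟩ := hN.exists_fst_fderiv_eq hp0 h ht
  have hfst : HasStrictFDerivAt (fun y ↦ (φ y).1) (α • ContinuousLinearMap.fst ℝ ℝ _) 0 :=
    hφ.fst.congr_fderiv (ContinuousLinearMap.ext hlin)
  obtain ⟨Ψ, Ψ', hΨ0, hΨ, hΨfst, hΨmap⟩ := exists_straightening hfst hα <| by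
    filter_upwards [h.isOpen.mem_nhds h.zero_mem] with y hy hy0 using hN.fst_eq_zero h hy hy0
  have hG : HasStrictFDerivAt (φ ∘ Ψ) ((fderiv ℝ φ 0).comp (Ψ' : _ →L[ℝ] _)) 0 :=
    (hΨ0.symm ▸ hφ : HasStrictFDerivAt φ (fderiv ℝ φ 0) (Ψ 0)).comp 0 hΨ
  have hmap : Filter.map (φ ∘ Ψ) (𝓝[halfSpace k] 0) = 𝓝[N] p := by
    rw [← Filter.map_map, show Filter.map Ψ (𝓝[halfSpace k] 0) = 𝓝[halfSpace k] 0 from hΨmap,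
      h.map_nhdsWithin h0, h.map_zero]
  obtain ⟨K, ε, hε, hερ, hcollar⟩ := exists_isRadialCollar_of_hasStrictFDerivAt hG
    ((h.immersion 0 h0).comp Ψ'.injective) (hmap.le self_mem_nhdsWithin)
    (nhdsWithin_le_nhds hΨfst) hρ
  refine ⟨k, φ ∘ Ψ, K, ε, hερ, hcollar, ?_⟩
  rw [← hmap, halfBall, inter_comm]
  exact Filter.image_mem_map (inter_mem_nhdsWithin _ (Metric.ball_mem_nhds 0 hε))

end Collar

section BlowDown

variable {n : ℕ} {a : EuclideanSpace ℝ (Fin n)} {q q' : ℝ × EuclideanSpace ℝ (Fin n)}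

theorem continuous_blowDown (a : EuclideanSpace ℝ (Fin n)) : Continuous (blowDown a) := by
  unfold blowDown
  fun_prop

theorem blowDown_of_fst_eq_zero (hq : q.1 = 0) : blowDown a q = a := by
  simp [blowDown, hq]

theorem dist_blowDown_center (hq : q ∈ blowUp n) : dist (blowDown a q) a = q.1 := by
  simp [blowDown, norm_smul, hq.2, abs_of_nonneg hq.1]

theorem dist_blowDown_le (hq : q ∈ blowUp n) (hq' : q' ∈ blowUp n) :
    dist (blowDown a q) (blowDown a q') ≤ |q.1 - q'.1| + q.1 * dist q.2 q'.2 := by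
  have h : blowDown a q - blowDown a q' = (q.1 - q'.1) • q'.2 + q.1 • (q.2 - q'.2) := by
    simp only [blowDown]
    module
  rw [dist_eq_norm, h, dist_eq_norm]
  refine (norm_add_le _ _).trans_eq ?_
  simp [norm_smul, hq'.2, abs_of_nonneg hq.1]

theorem abs_fst_sub_le (hq : q ∈ blowUp n) (hq' : q' ∈ blowUp n) :
    |q.1 - q'.1| ≤ dist (blowDown a q) (blowDown a q') := by
  rw [← dist_blowDown_center (a := a) hq, ← dist_blowDown_center (a := a) hq']
  exact abs_dist_sub_le _ _ _

theorem fst_mul_dist_snd_le (hq : q ∈ blowUp n) (hq' : q' ∈ blowUp n) :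
    q.1 * dist q.2 q'.2 ≤ 2 * dist (blowDown a q) (blowDown a q') := by
  have h : q.1 • (q.2 - q'.2) = (blowDown a q - blowDown a q') + (q'.1 - q.1) • q'.2 := by
    simp only [blowDown]
    module
  calc q.1 * dist q.2 q'.2 = ‖q.1 • (q.2 - q'.2)‖ := by
        rw [norm_smul, dist_eq_norm, Real.norm_of_nonneg hq.1]
    _ ≤ ‖blowDown a q - blowDown a q'‖ + ‖(q'.1 - q.1) • q'.2‖ := by
        rw [h]
        exact norm_add_le _ _
    _ = dist (blowDown a q) (blowDown a q') + |q.1 - q'.1| := by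
        rw [norm_smul, hq'.2, mul_one, ← dist_eq_norm, Real.norm_eq_abs, abs_sub_comm]
    _ ≤ _ := by linarith [abs_fst_sub_le (a := a) hq hq']

theorem max_fst_mul_dist_snd_le (hq : q ∈ blowUp n) (hq' : q' ∈ blowUp n) :
    max q.1 q'.1 * dist q.2 q'.2 ≤ 2 * dist (blowDown a q) (blowDown a q') := by
  rcases max_choice q.1 q'.1 with h | h <;> rw [h]
  · exact fst_mul_dist_snd_le hq hq'
  · rw [dist_comm q.2, dist_comm (blowDown a q)]
    exact fst_mul_dist_snd_le hq' hq

theorem max_fst_mul_dist_le (hq : q ∈ blowUp n) (hq' : q' ∈ blowUp n) :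
    max q.1 q'.1 * dist q q' ≤ (max q.1 q'.1 + 2) * dist (blowDown a q) (blowDown a q') := by
  have hmax : 0 ≤ max q.1 q'.1 := le_max_of_le_left hq.1
  rw [Prod.dist_eq, mul_max_of_nonneg _ _ hmax, add_mul]
  refine max_le (le_add_of_le_of_nonneg ?_ (by positivity))
    (le_add_of_nonneg_of_le (by positivity) (max_fst_mul_dist_snd_le hq hq'))
  gcongr
  exact abs_fst_sub_le hq hq'

theorem exists_mem_strictTransform {S : Set (EuclideanSpace ℝ (Fin n))}
    {x : EuclideanSpace ℝ (Fin n)} (hx : x ∈ S) (hxa : x ≠ a) :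
    ∃ q ∈ strictTransform S a, q.1 = dist x a ∧ blowDown a q = x := by
  have hne : ‖x - a‖ ≠ 0 := norm_ne_zero_iff.2 (sub_ne_zero.2 hxa)
  have hdown : blowDown a (dist x a, ‖x - a‖⁻¹ • (x - a)) = x := by
    simp [blowDown, dist_eq_norm, smul_smul, hne]
  refine ⟨(dist x a, ‖x - a‖⁻¹ • (x - a)), subset_closure ⟨⟨dist_nonneg, ?_⟩, ?_⟩, rfl, hdown⟩
  · simp [norm_smul, hne]
  · rw [mem_preimage, hdown]
    exact ⟨hx, hxa⟩

theorem edist_blowDown_center_le {η : ℝ} (hη : 0 < η)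
    (hq : q ∈ blowUp n) (hq' : q' ∈ blowUp n) (h : η ≤ dist q.2 q'.2) :
    edist (blowDown a q) a ≤ (2 / η).toNNReal * edist (blowDown a q) (blowDown a q') := by
  rw [edist_dist, edist_dist (blowDown a q) (blowDown a q'), dist_blowDown_center hq,
    ← ENNReal.ofReal, ← ENNReal.ofReal_mul (by positivity), div_mul_eq_mul_div]
  refine ENNReal.ofReal_le_ofReal ((le_div_iff₀ hη).2 ?_)
  exact (mul_le_mul_of_nonneg_left h hq.1).trans (fst_mul_dist_snd_le hq hq')

end BlowDown

section CollarBlowDown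

variable {n k : ℕ} {a : EuclideanSpace ℝ (Fin n)} {N : Set (ℝ × EuclideanSpace ℝ (Fin n))}
  {S : Set (EuclideanSpace ℝ (Fin n))} {y z : ℝ × EuclideanSpace ℝ (Fin k)} {K : ℝ≥0} {ε : ℝ}
  {G : ℝ × EuclideanSpace ℝ (Fin k) → ℝ × EuclideanSpace ℝ (Fin n)}

theorem fst_lt_of_mem_halfBall (hy : y ∈ halfBall k ε) : y.1 < ε :=
  (le_abs_self y.1).trans_lt ((norm_fst_le y).trans_lt (mem_ball_zero_iff.1 hy.1))

theorem IsRadialCollar.innerEDist_blowDown_le_ofReal (hG : IsRadialCollar N G K ε)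
    (hN : N ⊆ blowUp n) (hS : ∀ q ∈ N, q.1 < ε → blowDown a q ∈ S)
    (hy : y ∈ halfBall k ε) (hz : z ∈ halfBall k ε) :
    innerEDist S (blowDown a (G y)) (blowDown a (G z)) ≤
      ENNReal.ofReal (|y.1 - z.1| + max y.1 z.1 * (K * dist y z)) := by
  set c := |y.1 - z.1| + max y.1 z.1 * (K * dist y z)
  have hy0 : 0 ≤ y.1 := hy.2
  have hc : 0 ≤ c := by positivity
  let m : ℝ → ℝ × EuclideanSpace ℝ (Fin k) := AffineMap.lineMap y z
  have hm : ∀ t ∈ Icc (0 : ℝ) 1, m t ∈ halfBall k ε := fun t ht ↦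
    ((convex_ball 0 ε).inter (convex_halfSpace k)).lineMap_mem hy hz ht
  have hm_fst (t : ℝ) : (m t).1 = AffineMap.lineMap y.1 z.1 t := AffineMap.fst_lineMap y z t
  have hm_max : ∀ t ∈ Icc (0 : ℝ) 1, (m t).1 ≤ max y.1 z.1 := fun t ht ↦
    hm_fst t ▸ (convex_Iic (max y.1 z.1)).lineMap_mem (mem_Iic.2 (le_max_left _ _))
      (mem_Iic.2 (le_max_right _ _)) ht
  have hlip : LipschitzOnWith c.toNNReal (fun t ↦ blowDown a (G (m t))) (Icc 0 1) := by
    refine LipschitzOnWith.of_dist_le_mul fun s hs t ht ↦ ?_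
    rw [Real.coe_toNNReal c hc]
    have hfst : |(G (m s)).1 - (G (m t)).1| = dist s t * |y.1 - z.1| := by
      rw [hG.fst_eq _ (hm s hs), hG.fst_eq _ (hm t ht), hm_fst, hm_fst, ← Real.dist_eq,
        dist_lineMap_lineMap, Real.dist_eq y.1]
    have hsnd : dist (G (m s)).2 (G (m t)).2 ≤ K * (dist s t * dist y z) := by
      rw [← dist_lineMap_lineMap y z s t]
      exact (le_max_right _ _).trans (hG.lipschitz.dist_le_mul _ (hm s hs) _ (hm t ht))
    refine (dist_blowDown_le (hN (hG.mapsTo (hm s hs))) (hN (hG.mapsTo (hm t ht)))).trans ?_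
    calc |(G (m s)).1 - (G (m t)).1| + (G (m s)).1 * dist (G (m s)).2 (G (m t)).2
        ≤ dist s t * |y.1 - z.1| + max y.1 z.1 * (K * (dist s t * dist y z)) := by
          rw [hfst, hG.fst_eq _ (hm s hs)]
          gcongr
          exact hm_max s hs
      _ = c * dist s t := by ring
  have hmaps : MapsTo (fun t ↦ blowDown a (G (m t))) (Icc 0 1) S := fun t ht ↦
    hS _ (hG.mapsTo (hm t ht)) (hG.fst_eq _ (hm t ht) ▸ fst_lt_of_mem_halfBall (hm t ht))
  have hm0 : m 0 = y := AffineMap.lineMap_apply_zero y z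
  have hm1 : m 1 = z := AffineMap.lineMap_apply_one y z
  rw [← hm0, ← hm1]
  exact innerEDist_le_of_lipschitzOnWith hlip hmaps

theorem IsRadialCollar.innerEDist_blowDown_le (hG : IsRadialCollar N G K ε)
    (hN : N ⊆ blowUp n) (hS : ∀ q ∈ N, q.1 < ε → blowDown a q ∈ S)
    (hy : y ∈ halfBall k ε) (hz : z ∈ halfBall k ε) :
    innerEDist S (blowDown a (G y)) (blowDown a (G z)) ≤
      ENNReal.ofReal (1 + K * (K * (ε + 2))) * edist (blowDown a (G y)) (blowDown a (G z)) := by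
  have hyN := hN (hG.mapsTo hy)
  have hzN := hN (hG.mapsTo hz)
  set D := dist (blowDown a (G y)) (blowDown a (G z))
  have hy0 : 0 ≤ y.1 := hy.2
  have hfst : |y.1 - z.1| ≤ D := by
    rw [← hG.fst_eq y hy, ← hG.fst_eq z hz]
    exact abs_fst_sub_le hyN hzN
  have hanti : dist y z ≤ K * dist (G y) (G z) := hG.antilipschitz.le_mul_dist ⟨y, hy⟩ ⟨z, hz⟩
  have hmax : max y.1 z.1 * dist (G y) (G z) ≤ (max y.1 z.1 + 2) * D := by
    rw [← hG.fst_eq y hy, ← hG.fst_eq z hz]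
    exact max_fst_mul_dist_le hyN hzN
  have hmaxε : max y.1 z.1 * dist (G y) (G z) ≤ (ε + 2) * D := by
    refine hmax.trans (mul_le_mul_of_nonneg_right ?_ dist_nonneg)
    gcongr
    exact max_le (fst_lt_of_mem_halfBall hy).le (fst_lt_of_mem_halfBall hz).le
  refine (hG.innerEDist_blowDown_le_ofReal hN hS hy hz).trans ?_
  rw [edist_dist, ← ENNReal.ofReal_mul' dist_nonneg]
  refine ENNReal.ofReal_le_ofReal ?_
  calc |y.1 - z.1| + max y.1 z.1 * (K * dist y z)
      ≤ D + max y.1 z.1 * (K * (K * dist (G y) (G z))) := by gcongr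
    _ = D + K * (K * (max y.1 z.1 * dist (G y) (G z))) := by ring
    _ ≤ D + K * (K * ((ε + 2) * D)) := by gcongr
    _ = (1 + K * (K * (ε + 2))) * D := by ring

end CollarBlowDown

section StrictTransform

variable {n : ℕ} {a : EuclideanSpace ℝ (Fin n)} {S X s : Set (EuclideanSpace ℝ (Fin n))}
  {O : Set (ℝ × EuclideanSpace ℝ (Fin n))}

theorem isClosed_blowUp (n : ℕ) : IsClosed (blowUp n) :=
  (isClosed_le continuous_const continuous_fst).inter
    (isClosed_eq continuous_snd.norm continuous_const)

theorem strictTransform_subset_blowUp (S : Set (EuclideanSpace ℝ (Fin n)))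
    (a : EuclideanSpace ℝ (Fin n)) : strictTransform S a ⊆ blowUp n :=
  closure_minimal inter_subset_left (isClosed_blowUp n)

theorem strictTransform_mono (h : S ⊆ X) : strictTransform S a ⊆ strictTransform X a :=
  closure_mono fun _ hx ↦ ⟨hx.1, h hx.2.1, hx.2.2⟩

theorem isCompact_strictTransform_inter_fst_le (S : Set (EuclideanSpace ℝ (Fin n)))
    (a : EuclideanSpace ℝ (Fin n)) (c : ℝ) : IsCompact (strictTransform S a ∩ {q | q.1 ≤ c}) := by
  have hcpt : IsCompact (Icc 0 c ×ˢ Metric.sphere (0 : EuclideanSpace ℝ (Fin n)) 1) :=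
    isCompact_Icc.prod (isCompact_sphere 0 1)
  refine hcpt.of_isClosed_subset
    (isClosed_closure.inter (isClosed_le continuous_fst continuous_const)) fun q hq ↦ ?_
  have hqb := strictTransform_subset_blowUp S a hq.1
  exact ⟨⟨hqb.1, hq.2⟩, mem_sphere_zero_iff_norm.2 hqb.2⟩

theorem exists_forall_fst_lt_mem_of_mem_nhdsSet
    (hO : O ∈ 𝓝ˢ (strictTransform S a ∩ {q | q.1 ≤ 0})) :
    ∃ δ > 0, ∀ q ∈ strictTransform S a, q.1 < δ → q ∈ O := by
  obtain ⟨V, hV, hKV, hVO⟩ := mem_nhdsSet_iff_exists.1 hO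
  obtain ⟨δ, hδ, hmin⟩ :=
    ((isCompact_strictTransform_inter_fst_le S a 1).diff hV).exists_forall_le'
      continuous_fst.continuousOn (a := 0) fun q hq ↦ not_le.1 fun h ↦ hq.2 (hKV ⟨hq.1.1, h⟩)
  refine ⟨min δ 1, lt_min hδ one_pos, fun q hq hqδ ↦ hVO ?_⟩
  by_contra hqV
  have hq1 : q.1 ≤ 1 := hqδ.le.trans (min_le_right _ _)
  exact (hqδ.trans_le (min_le_left _ _)).not_ge (hmin q ⟨⟨hq, hq1⟩, hqV⟩)

theorem eventually_exists_mem_strictTransform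
    (hO : O ∈ 𝓝ˢ (strictTransform S a ∩ {q | q.1 ≤ 0})) :
    ∀ᶠ x in 𝓝 a, x ∈ S → x ≠ a → ∃ q ∈ strictTransform S a ∩ O, blowDown a q = x := by
  obtain ⟨δ, hδ, hδO⟩ := exists_forall_fst_lt_mem_of_mem_nhdsSet hO
  filter_upwards [Metric.ball_mem_nhds a hδ] with x hx hxS hxa
  obtain ⟨q, hq, hqx, rfl⟩ := exists_mem_strictTransform hxS hxa
  exact ⟨q, ⟨hq, hδO q hq (hqx.trans_lt hx)⟩, rfl⟩

theorem blowDown_mem_closure {q : ℝ × EuclideanSpace ℝ (Fin n)} (hq : q ∈ strictTransform S a) :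
    blowDown a q ∈ closure S :=
  map_mem_closure (continuous_blowDown a) hq fun _ hx ↦ hx.2.1

theorem exists_forall_blowDown_mem_inter {Z U : Set (EuclideanSpace ℝ (Fin n))}
    (hZ : IsClosed Z) (hU : U ∈ 𝓝 a) (hXZ : X ∩ U = Z ∩ U) (hs : s ∈ 𝓝 a) :
    ∃ ρ > 0, ∀ q ∈ strictTransform X a, q.1 < ρ → blowDown a q ∈ X ∩ s := by
  obtain ⟨ρ, hρ, hρU⟩ := Metric.mem_nhds_iff.1 (Filter.inter_mem hs hU)
  refine ⟨ρ, hρ, fun q hq hqρ ↦ ?_⟩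
  have hball : blowDown a q ∈ Metric.ball a ρ := by
    rwa [Metric.mem_ball, dist_blowDown_center (strictTransform_subset_blowUp X a hq)]
  have hclosure : blowDown a q ∈ closure (Metric.ball a ρ ∩ X) :=
    Metric.isOpen_ball.inter_closure ⟨hball, blowDown_mem_closure hq⟩
  have hsubset : Metric.ball a ρ ∩ X ⊆ Z := fun x hx ↦ (hXZ.subset ⟨hx.2, (hρU hx.1).2⟩).1
  exact ⟨(hXZ.superset ⟨hZ.closure_subset_iff.2 hsubset hclosure, (hρU hball).2⟩).1,
    (hρU hball).1⟩

end StrictTransform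

section ConicPoint

variable {n : ℕ} {a : EuclideanSpace ℝ (Fin n)} {N : Set (ℝ × EuclideanSpace ℝ (Fin n))}
  {S X s : Set (EuclideanSpace ℝ (Fin n))} {ρ : ℝ} {p p' : ℝ × EuclideanSpace ℝ (Fin n)}

theorem IsPSubmanifold.eventually_innerEDist_blowDown_le_of_eq (hN : IsPSubmanifold N)
    (hρ : 0 < ρ) (hS : ∀ q ∈ N, q.1 < ρ → blowDown a q ∈ S) (hp : p ∈ N) (hp0 : p.1 = 0) :
    ∃ C : ℝ≥0, ∀ᶠ q in 𝓝 (p, p), q.1 ∈ N → q.2 ∈ N →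
      innerEDist S (blowDown a q.1) (blowDown a q.2) ≤
        C * edist (blowDown a q.1) (blowDown a q.2) := by
  obtain ⟨k, G, K, ε, hερ, hG, himage⟩ := hN.exists_isRadialCollar hp hp0 hρ
  have hmem : ∀ᶠ q in 𝓝 p, q ∈ N → q ∈ G '' halfBall k ε := eventually_nhdsWithin_iff.1 himage
  refine ⟨(1 + K * (K * (ε + 2))).toNNReal, ?_⟩
  rw [nhds_prod_eq]
  filter_upwards [hmem.prod_mk hmem] with ⟨q, q'⟩ hq hqN hqN'
  obtain ⟨y, hy, rfl⟩ := hq.1 hqN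
  obtain ⟨z, hz, rfl⟩ := hq.2 hqN'
  exact hG.innerEDist_blowDown_le hN.subset (fun q hq hqε ↦ hS q hq (hqε.trans_le hερ)) hy hz

theorem IsPSubmanifold.eventually_innerEDist_blowDown_center_le (hN : IsPSubmanifold N)
    (hρ : 0 < ρ) (hS : ∀ q ∈ N, q.1 < ρ → blowDown a q ∈ S) (hp : p ∈ N) (hp0 : p.1 = 0) :
    ∃ C : ℝ≥0, ∀ᶠ q in 𝓝 p, q ∈ N →
      innerEDist S (blowDown a q) a ≤ C * edist (blowDown a q) a := by
  obtain ⟨C, hC⟩ := hN.eventually_innerEDist_blowDown_le_of_eq hρ hS hp hp0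
  refine ⟨C, ?_⟩
  filter_upwards [hC.curry_nhds] with q hq hqN
  simpa only [blowDown_of_fst_eq_zero hp0] using hq.self_of_nhds hqN hp

theorem IsPSubmanifold.eventually_innerEDist_blowDown_le_of_ne (hN : IsPSubmanifold N)
    (hρ : 0 < ρ) (hS : ∀ q ∈ N, q.1 < ρ → blowDown a q ∈ S) (hp : p ∈ N) (hp0 : p.1 = 0)
    (hp' : p' ∈ N) (hp0' : p'.1 = 0) (hpp' : p ≠ p') :
    ∃ C : ℝ≥0, ∀ᶠ q in 𝓝 (p, p'), q.1 ∈ N → q.2 ∈ N →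
      innerEDist S (blowDown a q.1) (blowDown a q.2) ≤
        C * edist (blowDown a q.1) (blowDown a q.2) := by
  have hdir : 0 < dist p.2 p'.2 := dist_pos.2 fun h ↦ hpp' (Prod.ext (hp0.trans hp0'.symm) h)
  obtain ⟨C, hC⟩ := hN.eventually_innerEDist_blowDown_center_le hρ hS hp hp0
  obtain ⟨C', hC'⟩ := hN.eventually_innerEDist_blowDown_center_le hρ hS hp' hp0'
  obtain ⟨η, hη, hηdir⟩ := exists_between hdir
  have hsep : ∀ᶠ q : (ℝ × EuclideanSpace ℝ (Fin n)) × (ℝ × EuclideanSpace ℝ (Fin n)) in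
      𝓝 (p, p'), η < dist q.1.2 q.2.2 :=
    ContinuousAt.eventually_lt (by fun_prop) (by fun_prop) hηdir
  refine ⟨(C + C') * (2 / η).toNNReal, ?_⟩
  filter_upwards [hsep, hC.prod_inl_nhds p', hC'.prod_inr_nhds p] with q hq hqC hqC' hqN hqN'
  set D := edist (blowDown a q.1) (blowDown a q.2)
  have hD : edist (blowDown a q.1) a ≤ (2 / η).toNNReal * D :=
    edist_blowDown_center_le hη (hN.subset hqN) (hN.subset hqN') hq.le
  have hD' : edist (blowDown a q.2) a ≤ (2 / η).toNNReal * D := by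
    rw [show D = _ from edist_comm _ _]
    exact edist_blowDown_center_le hη (hN.subset hqN') (hN.subset hqN) (dist_comm q.1.2 _ ▸ hq.le)
  calc innerEDist S (blowDown a q.1) (blowDown a q.2)
      ≤ innerEDist S (blowDown a q.1) a + innerEDist S (blowDown a q.2) a := by
        rw [innerEDist_comm S (blowDown a q.2)]
        exact innerEDist_triangle _ _ _ _
    _ ≤ C * ((2 / η).toNNReal * D) + C' * ((2 / η).toNNReal * D) :=
        add_le_add ((hqC hqN).trans (by gcongr)) ((hqC' hqN').trans (by gcongr))
    _ = ((C + C') * (2 / η).toNNReal : ℝ≥0) * D := by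
        push_cast
        ring

theorem IsPSubmanifold.exists_mem_nhdsSet_innerEDist_blowDown_le (hN : IsPSubmanifold N)
    (hρ : 0 < ρ) (hS : ∀ q ∈ N, q.1 < ρ → blowDown a q ∈ S)
    {K : Set (ℝ × EuclideanSpace ℝ (Fin n))} (hK : IsCompact K) (hKN : K ⊆ N)
    (hK0 : ∀ q ∈ K, q.1 = 0) :
    ∃ C : ℝ≥0, ∃ O ∈ 𝓝ˢ K, ∀ q ∈ N ∩ O, ∀ q' ∈ N ∩ O,
      innerEDist S (blowDown a q) (blowDown a q') ≤
        C * edist (blowDown a q) (blowDown a q') := by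
  let P : ℝ≥0 → (ℝ × EuclideanSpace ℝ (Fin n)) × (ℝ × EuclideanSpace ℝ (Fin n)) → Prop :=
    fun C q ↦ q.1 ∈ N → q.2 ∈ N → innerEDist S (blowDown a q.1) (blowDown a q.2) ≤
      C * edist (blowDown a q.1) (blowDown a q.2)
  have hP (q) : Monotone (P · q) := fun C C' hCC' h hq hq' ↦ (h hq hq').trans (by gcongr)
  have hlocal : ∀ p ∈ K ×ˢ K, ∃ C, ∀ᶠ q in 𝓝 p, P C q := by
    rintro ⟨p, p'⟩ ⟨hp, hp'⟩
    obtain rfl | hpp' := eq_or_ne p p'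
    · exact hN.eventually_innerEDist_blowDown_le_of_eq hρ hS (hKN hp) (hK0 p hp)
    · exact hN.eventually_innerEDist_blowDown_le_of_ne hρ hS (hKN hp) (hK0 p hp) (hKN hp')
        (hK0 p' hp') hpp'
  obtain ⟨C, hC⟩ := exists_eventually_nhdsSet_of_forall_exists (hK.prod hK) hP hlocal
  rw [hK.nhdsSet_prod_eq hK] at hC
  obtain ⟨O, hO, hOC⟩ := Filter.mem_prod_self_iff.1 hC
  refine ⟨C, O, hO, ?_⟩
  rintro q ⟨hqN, hqO⟩ q' ⟨hqN', hqO'⟩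
  have hqq' : P C (q, q') := hOC (mk_mem_prod hqO hqO')
  exact hqq' hqN hqN'

theorem IsConicPoint.isLNEAt_inter (h : IsConicPoint X a) (hs : s ∈ 𝓝 a) :
    IsLNEAt (X ∩ s) a := by
  obtain ⟨-, ⟨Z, U, hZ, hU, haU, hXZ⟩, r, hr, hN⟩ := h
  set T := strictTransform (X ∩ Metric.ball a r) a
  set K := T ∩ {q | q.1 ≤ 0}
  obtain hK | ⟨p, hp⟩ := K.eq_empty_or_nonempty
  · refine isLNEAt_of_eventually_eq ?_
    have hT : ∅ ∈ 𝓝ˢ K := by simp [hK]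
    filter_upwards [eventually_exists_mem_strictTransform hT, Metric.ball_mem_nhds a hr]
      with x hx hxr hxX
    by_contra hxa
    simpa using hx ⟨hxX.1, hxr⟩ hxa
  have hKr : K ⊆ {q | q.1 < r} := fun q hq ↦ hq.2.trans_lt hr
  have hK0 : ∀ q ∈ K, q.1 = 0 := fun q hq ↦
    le_antisymm hq.2 (strictTransform_subset_blowUp _ a hq.1).1
  obtain ⟨ρ, hρ, hS⟩ := exists_forall_blowDown_mem_inter hZ (hU.mem_nhds haU) hXZ hs
  obtain ⟨C, O, hO, hC⟩ := hN.exists_mem_nhdsSet_innerEDist_blowDown_le hρ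
    (fun q hq ↦ hS q (strictTransform_mono inter_subset_left hq.1))
    (isCompact_strictTransform_inter_fst_le _ a 0) (fun q hq ↦ ⟨hq.1, hKr hq⟩) hK0
  have hOr : O ∩ {q | q.1 < r} ∈ 𝓝ˢ K :=
    Filter.inter_mem hO ((isOpen_lt continuous_fst continuous_const).mem_nhdsSet.2 hKr)
  have hlift : ∀ᶠ x in 𝓝 a, x ∈ X → ∃ q ∈ T ∩ (O ∩ {q | q.1 < r}), blowDown a q = x := by
    filter_upwards [eventually_exists_mem_strictTransform hOr, Metric.ball_mem_nhds a hr]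
      with x hx hxr hxX
    obtain rfl | hxa := eq_or_ne x a
    · exact ⟨p, ⟨hp.1, subset_of_mem_nhdsSet hOr hp⟩, blowDown_of_fst_eq_zero (hK0 p hp)⟩
    · exact hx ⟨hxX, hxr⟩ hxa
  refine ⟨C, ?_⟩
  rw [nhds_prod_eq]
  filter_upwards [hlift.prod_mk hlift] with ⟨x, y⟩ ⟨hx, hy⟩ hxX hyX
  obtain ⟨q, ⟨hqT, hqO, hqr⟩, rfl⟩ := hx hxX.1
  obtain ⟨q', ⟨hqT', hqO', hqr'⟩, rfl⟩ := hy hyX.1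
  exact hC q ⟨⟨hqT, hqr⟩, hqO⟩ q' ⟨⟨hqT', hqr'⟩, hqO'⟩

end ConicPoint

section Manifold

variable {n : ℕ} {M : Type*} [PseudoEMetricSpace M] [ChartedSpace (EuclideanSpace ℝ (Fin n)) M]
  [IsManifold (𝓡 n) 1 M] [RiemannianBundle (fun x : M => TangentSpace (𝓡 n) x)]
  [IsContinuousRiemannianBundle (EuclideanSpace ℝ (Fin n)) (fun x : M => TangentSpace (𝓡 n) x)]
  [IsRiemannianManifold (𝓡 n) M] {W : Set M} {z : M}

theorem IsConicAt.isLNEAt (h : IsConicAt n W z) : IsLNEAt W z := by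
  obtain ⟨ψ, hψ, hconic⟩ := h
  have hatlas : ψ ∈ IsManifold.maximalAtlas (𝓡 n) 1 M :=
    IsManifold.maximalAtlas_subset_of_le (by simp) hψ.mem_atlas
  obtain ⟨K, s, hs, hK⟩ := exists_lipschitzOnWith_chart hatlas hψ.mem_source
  obtain ⟨K', t, ht, hK'⟩ := exists_lipschitzOnWith_chart_symm hatlas hψ.mem_source
  obtain ⟨L, hL⟩ := hconic.isLNEAt_inter ht
  set X := ψ '' (W ∩ ψ.source) ∩ t
  have hmaps : MapsTo ψ.symm X W := by
    rintro _ ⟨⟨w, ⟨hw, hws⟩, rfl⟩, -⟩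
    rwa [ψ.left_inv hws]
  have hψz : ContinuousAt ψ z := ψ.continuousAt hψ.mem_source
  have hnear : s ∩ ψ.source ∩ ψ ⁻¹' t ∈ 𝓝 z :=
    Filter.inter_mem (Filter.inter_mem hs (ψ.open_source.mem_nhds hψ.mem_source)) (hψz ht)
  refine ⟨(K' + 1) * (L * K), ?_⟩
  filter_upwards [prod_mem_nhds hnear hnear, (hψz.prodMap hψz).eventually hL]
    with ⟨x, y⟩ ⟨⟨⟨hxs, hxψ⟩, hxt⟩, ⟨⟨hys, hyψ⟩, hyt⟩⟩ hxy hx hy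
  have hpush : innerEDist W x y ≤ (K' + 1 : ℝ≥0) * innerEDist X (ψ x) (ψ y) := by
    simpa only [ψ.left_inv hxψ, ψ.left_inv hyψ] using innerEDist_map_le (K := K' + 1)
      (by positivity) ((hK'.mono inter_subset_right).weaken le_self_add) hmaps (ψ x) (ψ y)
  calc innerEDist W x y ≤ (K' + 1 : ℝ≥0) * innerEDist X (ψ x) (ψ y) := hpush
    _ ≤ (K' + 1 : ℝ≥0) * (L * edist (ψ x) (ψ y)) := by
        gcongr
        exact hxy ⟨mem_image_of_mem ψ ⟨hx, hxψ⟩, hxt⟩ ⟨mem_image_of_mem ψ ⟨hy, hyψ⟩, hyt⟩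
    _ ≤ (K' + 1 : ℝ≥0) * (L * (K * edist x y)) := by
        gcongr
        exact hK hxs hys
    _ = ((K' + 1) * (L * K) : ℝ≥0) * edist x y := by
        push_cast
        ring

end Manifold

end ConicLNE

theorem theorem3p2_general (n : ℕ) (M : Type*) [EMetricSpace M]
    [ChartedSpace (EuclideanSpace ℝ (Fin n)) M] [IsManifold (𝓡 n) 1 M]
    [RiemannianBundle (fun x : M => TangentSpace (𝓡 n) x)]
    [IsContinuousRiemannianBundle (EuclideanSpace ℝ (Fin n)) (fun x : M => TangentSpace (𝓡 n) x)]
    [IsRiemannianManifold (𝓡 n) M]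
    (W : Set M) (hconic : ∀ z ∈ W, ConicLNE.IsConicAt n W z)
    (hcompact : IsCompact W) (hconn : IsPreconnected W) :
    ConicLNE.IsLNE W :=
  ConicLNE.isLNE_of_forall_isLNEAt hcompact hconn fun z hz ↦ (hconic z hz).isLNEAt

theorem theorem3p2 (n : ℕ) (M : Type*) [EMetricSpace M]
    [ChartedSpace (EuclideanSpace ℝ (Fin n)) M] [IsManifold (𝓡 n) ∞ M]
    [RiemannianBundle (fun x : M => TangentSpace (𝓡 n) x)]
    [IsContMDiffRiemannianBundle (𝓡 n) ∞ (EuclideanSpace ℝ (Fin n))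
      (fun x : M => TangentSpace (𝓡 n) x)]
    [IsRiemannianManifold (𝓡 n) M]
    (W : Set M) (hconic : ConicLNE.IsConicSingularSubmanifold n W)
    (hcompact : IsCompact W) (hconn : IsConnected W) :
    ConicLNE.IsLNE W := by
  have : IsManifold (𝓡 n) 1 M := .of_le (n := ∞) (by simp)
  have := ConicLNE.isContinuousRiemannianBundle_of_isContMDiffRiemannianBundle (𝓡 n) ∞
    (EuclideanSpace ℝ (Fin n)) (fun x : M => TangentSpace (𝓡 n) x)
  exact theorem3p2_general n M W hconic.conic hcompact hconn.isPreconnected
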